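/- Let $\mathcal A,\mathcal B$ be finite sets. A flip pair over $\mathcal A$ is a pair $(A,J)$ of zero-one $\mathcal A\times\mathcal A$ matrices with $AJ=JA^{\mathsf T}$ and $J^2=I$. Then for every $a \in \mathcal A$ there is a unique $\tau_J(a)\in\mathcal A$ with $J(a,\tau_J(a))=1$. Let $\mathsf X_A=\{x\in\mathcal A^{\mathbb Z}: A(x_i,x_{i+1})=1 \text{ for all } i\in\mathbb Z\}$, with the topology induced by the product of the discrete topologies, let $\sigma_A(x)_i=x_{i+1}$ be the shift map on $\mathsf X_A$, and let $\varphi_{A,J}(x)_i=\tau_J(x_{-i})$ for $x \in \mathsf X_A$. Triples $(X,T,F)$ and $(X',T',F')$, where $T$ is a homeomorphism of $X$ and $F$ is a homeomorphism of $X$ with $F\circ T^{-1}=T\circ F$ and $F^2=\mathrm{Id}$ (and similarly for $T', F'$), are called $D_\infty$-conjugate if there is a homeomorphism $\theta:X\to X'$ with $\theta\circ T=T'\circ\theta$ and $\theta\circ F=F'\circ\theta$. A $D_\infty$-half elementary equivalence from a flip pair $(A,J)$ to a flip pair $(B,K)$ is a pair $(D,E)$ of zero-one matrices, $D$ of size $\mathcal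 A\times\mathcal B$ and $E$ of size $\mathcal B\times\mathcal A$, such that $A=DE$, $B=ED$ and $E=KD^{\mathsf T}J$. For a positive integer $l$, a $D_\infty$-strong shift equivalence ($D_\infty$-SSE) of lag $l$ from $(A,J)$ to $(B,K)$ is a chain of $l$ consecutive $D_\infty$-half elementary equivalences, passing through arbitrary flip pairs over finite sets, which begins at $(A,J)$ and ends at $(B,K)$. Let $(A,J)$ and $(B,K)$ be flip pairs over finite sets. (1) $(\mathsf X_A,\sigma_A,\varphi_{A,J})$ and $(\mathsf X_B,\sigma_B,\varphi_{B,K})$ are $D_\infty$-conjugate if and only if there is a $D_\infty$-SSE of lag $2l$ from $(A,J)$ to $(B,K)$ for some positive integer $l$. (2) $(\mathsf X_A,\sigma_A,\varphi_{A,J})$ and $(\mathsf X_B,\sigma_B,\sigma_B\circ\varphi_{B,K})$ are $D_\infty$-conjugate if and only if there is a $D_\infty$-SSE of lag $2l-1$ from $(A,J)$ to $(B,K)$ for some positive integer $l$. -/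

import Mathlib

universe u v

/-- A topological flip system, or `D∞`-system, `(X, T, F)`: a topological space `X`, a
homeomorphism `T` of `X`, and a topological conjugacy `F` from `(X, T⁻¹)` to `(X, T)` with
`F ∘ F = id`. -/
structure FlipSystem : Type (u + 1) where
  X : Type u
  [top : TopologicalSpace X]
  T : X ≃ₜ X
  F : X ≃ₜ X
  flip_conj : ∀ x, F (T.symm x) = T (F x)
  flip_invol : ∀ x, F (F x) = x

namespace FlipSystem

instance (S : FlipSystem.{u}) : TopologicalSpace S.X := S.top

/-- `D∞`-conjugacy: a homeomorphism commuting with the action of `D∞`, that is, with the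
two generators `T` and `F`. -/
def Conjugate (S : FlipSystem.{u}) (S' : FlipSystem.{v}) : Prop :=
  ∃ θ : S.X ≃ₜ S'.X, (∀ x, θ (S.T x) = S'.T (θ x)) ∧ (∀ x, θ (S.F x) = S'.F (θ x))

/-- The `D∞`-system `(X, T, T ∘ F)`. -/
def twist (S : FlipSystem.{u}) : FlipSystem.{u} where
  X := S.X
  T := S.T
  F := S.F.trans S.T
  flip_conj x := by
    change S.T (S.F (S.T.symm x)) = S.T (S.T (S.F x))
    rw [S.flip_conj]
  flip_invol x := by
    change S.T (S.F (S.T (S.F x))) = x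
    rw [← S.flip_conj, S.T.symm_apply_apply, S.flip_invol]

end FlipSystem

/-- All entries of the matrix are `0` or `1`. -/
def Matrix.IsZeroOne {α : Type u} {β : Type v} (M : Matrix α β ℕ) : Prop :=
  ∀ a b, M a b = 0 ∨ M a b = 1

/-- A flip pair `(A, J)` over a finite alphabet: zero-one square matrices with
`A J = J Aᵀ` and `J² = I`. -/
structure FlipPair : Type (u + 1) where
  Alphabet : Type u
  [fintype : Fintype Alphabet]
  [decEq : DecidableEq Alphabet]
  A : Matrix Alphabet Alphabet ℕ
  J : Matrix Alphabet Alphabet ℕ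
  zeroOne_A : A.IsZeroOne
  zeroOne_J : J.IsZeroOne
  mul_flip : A * J = J * A.transpose
  flip_sq : J * J = 1

namespace FlipPair

instance (P : FlipPair.{u}) : Fintype P.Alphabet := P.fintype

instance (P : FlipPair.{u}) : DecidableEq P.Alphabet := P.decEq

/-- The alphabet carries the discrete topology (and `Alphabet ^ ℤ` the product topology). -/
instance (P : FlipPair.{u}) : TopologicalSpace P.Alphabet := ⊥

instance (P : FlipPair.{u}) : DiscreteTopology P.Alphabet := ⟨rfl⟩

theorem eq_of_J {P : FlipPair.{u}} {a b c : P.Alphabet} (h : P.J c a = 1) (h' : P.J a b = 1) :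
    c = b := by
  by_contra hne
  have h0 : (P.J * P.J) c b = 0 := by rw [P.flip_sq, Matrix.one_apply_ne hne]
  rw [Matrix.mul_apply, Finset.sum_eq_zero_iff] at h0
  have := h0 a (Finset.mem_univ a)
  rw [h, h'] at this
  exact one_ne_zero this

theorem exists_J (P : FlipPair.{u}) (a : P.Alphabet) : ∃ b, P.J a b = 1 ∧ P.J b a = 1 := by
  have h1 : (P.J * P.J) a a ≠ 0 := by rw [P.flip_sq, Matrix.one_apply_eq]; exact one_ne_zero
  rw [Matrix.mul_apply] at h1
  obtain ⟨b, -, hb⟩ := Finset.exists_ne_zero_of_sum_ne_zero h1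
  exact ⟨b, (P.zeroOne_J a b).resolve_left (left_ne_zero_of_mul hb),
    (P.zeroOne_J b a).resolve_left (right_ne_zero_of_mul hb)⟩

/-- The permutation `τ_J` of the alphabet: `τ_J a` is the unique `b` with `J a b = 1`. -/
noncomputable def tau (P : FlipPair.{u}) (a : P.Alphabet) : P.Alphabet :=
  Classical.choose (P.exists_J a)

theorem J_eq_one_iff (P : FlipPair.{u}) (a b : P.Alphabet) : P.J a b = 1 ↔ P.tau a = b := by
  have hs := Classical.choose_spec (P.exists_J a)
  refine ⟨fun h => eq_of_J hs.2 h, ?_⟩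
  rintro rfl
  exact hs.1

theorem tau_tau (P : FlipPair.{u}) (a : P.Alphabet) : P.tau (P.tau a) = a :=
  (P.J_eq_one_iff _ _).1 (Classical.choose_spec (P.exists_J a)).2

theorem J_apply (P : FlipPair.{u}) (a b : P.Alphabet) :
    P.J a b = if P.tau a = b then 1 else 0 := by
  split_ifs with h
  · exact (P.J_eq_one_iff a b).2 h
  · exact (P.zeroOne_J a b).resolve_right fun h' => h ((P.J_eq_one_iff a b).1 h')

theorem A_tau (P : FlipPair.{u}) (a b : P.Alphabet) : P.A (P.tau b) (P.tau a) = P.A a b := by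
  have h := congrFun (congrFun P.mul_flip a) (P.tau b)
  have hinj : ∀ c, P.tau c = P.tau b ↔ c = b := fun c =>
    ⟨fun hc => by rw [← P.tau_tau c, hc, P.tau_tau], fun hc => by rw [hc]⟩
  simpa [Matrix.mul_apply, J_apply, hinj] using h.symm

/-- The topological Markov chain `X_A` of bi-infinite sequences `x` with
`A (x i) (x (i + 1)) = 1` for all `i`. -/
def shiftSpace (P : FlipPair.{u}) : Set (ℤ → P.Alphabet) :=
  {x | ∀ i : ℤ, P.A (x i) (x (i + 1)) = 1}

/-- The coordinatewise translation of points of `X_A` by `n`, `x ↦ (x_{i+n})_i`. -/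
def translate (P : FlipPair.{u}) (n : ℤ) (x : P.shiftSpace) : P.shiftSpace :=
  ⟨fun i => x.1 (i + n), fun i => by
    have h := x.2 (i + n)
    rwa [add_right_comm] at h⟩

theorem continuous_translate (P : FlipPair.{u}) (n : ℤ) : Continuous (P.translate n) := by
  refine Continuous.subtype_mk (continuous_pi fun i => ?_) _
  have h : Continuous fun x : P.shiftSpace => x.1 (i + n) :=
    (continuous_apply (i + n)).comp continuous_subtype_val
  exact h

/-- The shift map `σ_A` on `X_A`, `σ_A(x)_i = x_{i+1}`. -/
def shift (P : FlipPair.{u}) : P.shiftSpace ≃ₜ P.shiftSpace where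
  toFun := P.translate 1
  invFun := P.translate (-1)
  left_inv x := Subtype.ext (funext fun i => by simp [translate])
  right_inv x := Subtype.ext (funext fun i => by simp [translate])
  continuous_toFun := P.continuous_translate 1
  continuous_invFun := P.continuous_translate (-1)

/-- The map `φ_{A,J}` on `X_A`, `φ_{A,J}(x)_i = τ_J(x_{-i})`. -/
noncomputable def flipMap (P : FlipPair.{u}) (x : P.shiftSpace) : P.shiftSpace :=
  ⟨fun i => P.tau (x.1 (-i)), fun i => by
    rw [A_tau]
    have h := x.2 (-(i + 1))
    rwa [show -(i + 1) + 1 = -i by ring] at h⟩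

theorem flipMap_flipMap (P : FlipPair.{u}) (x : P.shiftSpace) :
    P.flipMap (P.flipMap x) = x :=
  Subtype.ext (funext fun i => by simp [flipMap, tau_tau])

theorem continuous_flipMap (P : FlipPair.{u}) : Continuous P.flipMap := by
  refine Continuous.subtype_mk (continuous_pi fun i => ?_) _
  have h : Continuous fun x : P.shiftSpace => x.1 (-i) :=
    (continuous_apply (-i)).comp continuous_subtype_val
  exact (continuous_of_discreteTopology (f := P.tau)).comp h

/-- The `D∞`-topological Markov chain `(X_A, σ_A, φ_{A,J})`. -/
noncomputable def system (P : FlipPair.{u}) : FlipSystem.{u} where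
  X := P.shiftSpace
  T := P.shift
  F :=
    { toFun := P.flipMap
      invFun := P.flipMap
      left_inv := P.flipMap_flipMap
      right_inv := P.flipMap_flipMap
      continuous_toFun := P.continuous_flipMap
      continuous_invFun := P.continuous_flipMap }
  flip_conj x := Subtype.ext (funext fun i => by
    change P.tau (x.1 (-i + -1)) = P.tau (x.1 (-(i + 1)))
    rw [neg_add])
  flip_invol := P.flipMap_flipMap

/-- `(D, E)` is a `D∞`-half elementary equivalence from `(A, J)` to `(B, K)`: `D` and `E` are
zero-one matrices with `A = D E`, `B = E D` and `E = K Dᵀ J`. -/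
structure IsHalfElementary (P Q : FlipPair.{u}) (D : Matrix P.Alphabet Q.Alphabet ℕ)
    (E : Matrix Q.Alphabet P.Alphabet ℕ) : Prop where
  zeroOne_D : D.IsZeroOne
  zeroOne_E : E.IsZeroOne
  left_eq : P.A = D * E
  right_eq : Q.A = E * D
  flip_eq : E = Q.J * D.transpose * P.J

/-- `StrongShiftEquiv l P Q`: there is a `D∞`-strong shift equivalence of lag `l` from `P` to
`Q`, i.e. a chain of `l ≥ 1` consecutive `D∞`-half elementary equivalences, passing through
arbitrary flip pairs, which begins at `P` and ends at `Q`. -/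
inductive StrongShiftEquiv : ℕ → FlipPair.{u} → FlipPair.{u} → Prop
  | single {P Q : FlipPair.{u}} (D : Matrix P.Alphabet Q.Alphabet ℕ)
      (E : Matrix Q.Alphabet P.Alphabet ℕ) (h : IsHalfElementary P Q D E) :
      StrongShiftEquiv 1 P Q
  | cons {l : ℕ} {P Q R : FlipPair.{u}} (D : Matrix P.Alphabet Q.Alphabet ℕ)
      (E : Matrix Q.Alphabet P.Alphabet ℕ) (h : IsHalfElementary P Q D E)
      (t : StrongShiftEquiv l Q R) : StrongShiftEquiv (l + 1) P R

end FlipPair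

/-! A factorization `A = D * E` with `A` zero-one says that every edge of `A` passes through exactly
one letter of `B`, so it defines a two-block code. The condition `E = K Dᵀ J` makes the code respect
the flips up to one shift, because reversing time sends the edge at `(i, i + 1)` to the edge at `(-i
- 1, -i)`. One half elementary equivalence is thus a conjugacy onto the twisted system
(`HalfRel.conjugate_twist`). Twisting twice is undone by the shift, so only the parity of the lag
matters (`StrongShiftEquiv.conjugate`).

For the converse in even lag, trimming makes both pairs essential (`exists_essential`). A conjugacy
then puts both chains on one space `X`, where each flip pair induces the partition of `X` by the
symbol at coordinate 0. Splitting letters by labels of their neighbours costs lag two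
(`evenEquiv_split`) and refines this partition by translates of a coarser flip-invariant one
(`exists_split_cover`). Since a conjugacy and its inverse are finite block codes, finitely many
refinements on each side reach the same partition. Essential pairs with the same partition are
isomorphic (`evenEquiv_of_same_kernel`), hence equivalent in lag two.

The odd case reduces to the even one by replacing `Q` with its edge pair, which is one half
elementary equivalence away. -/

namespace FlipSystem

theorem Conjugate.symm {S S' : FlipSystem.{u}} (h : S.Conjugate S') : S'.Conjugate S := by
  obtain ⟨θ, hT, hF⟩ := h
  refine ⟨θ.symm, fun x => ?_, fun x => ?_⟩
  · rw [θ.symm_apply_eq, hT, θ.apply_symm_apply]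
  · rw [θ.symm_apply_eq, hF, θ.apply_symm_apply]

theorem Conjugate.trans {S S' S'' : FlipSystem.{u}} (h : S.Conjugate S')
    (h' : S'.Conjugate S'') : S.Conjugate S'' := by
  obtain ⟨θ, hT, hF⟩ := h
  obtain ⟨η, gT, gF⟩ := h'
  refine ⟨θ.trans η, fun x => ?_, fun x => ?_⟩
  · simp [hT, gT]
  · simp [hF, gF]

theorem Conjugate.twist {S S' : FlipSystem.{u}} (h : S.Conjugate S') :
    S.twist.Conjugate S'.twist := by
  obtain ⟨θ, hT, hF⟩ := h
  refine ⟨θ, hT, fun x => ?_⟩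
  change θ (S.T (S.F x)) = S'.T (S'.F (θ x))
  exact (hT _).trans (congrArg S'.T (hF x))

/-- The conjugacy is `T` itself: `T F T⁻¹ = T² F` by the flip relation. -/
theorem conjugate_twist_twist (S : FlipSystem.{u}) : S.Conjugate S.twist.twist := by
  refine ⟨S.T, fun x => rfl, fun x => ?_⟩
  change S.T (S.F x) = S.T (S.T (S.F (S.T x)))
  rw [← S.flip_conj (S.T x), S.T.symm_apply_apply]

end FlipSystem

namespace FlipPair

theorem tau_injective (P : FlipPair.{u}) : Function.Injective P.tau :=
  Function.LeftInverse.injective P.tau_tau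

/-- The flip pair of a finite graph with an orientation-reversing involution of the vertices. -/
noncomputable def ofRel {α : Type u} [Finite α] (r : α → α → Prop) (t : α → α)
    (ht : ∀ a, t (t a) = a) (hr : ∀ a b, r a b → r (t b) (t a)) : FlipPair.{u} :=
  letI : Fintype α := Fintype.ofFinite α
  letI : DecidableEq α := Classical.decEq α
  letI : ∀ a b, Decidable (r a b) := fun _ _ => Classical.propDecidable _
  { Alphabet := α
    A := Matrix.of fun a b => if r a b then 1 else 0
    J := Matrix.of fun a b => if t a = b then 1 else 0
    zeroOne_A := fun a b => by dsimp only [Matrix.of_apply]; split_ifs <;> simp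
    zeroOne_J := fun a b => by dsimp only [Matrix.of_apply]; split_ifs <;> simp
    mul_flip := by
      have h1 : ∀ a b, t a = b ↔ a = t b := fun a b =>
        ⟨fun h => by rw [← h, ht], fun h => by rw [h, ht]⟩
      have h2 : ∀ a b, r a (t b) ↔ r b (t a) := fun a b =>
        ⟨fun h => by simpa [ht] using hr _ _ h, fun h => by simpa [ht] using hr _ _ h⟩
      ext a b
      rw [Matrix.mul_apply, Matrix.mul_apply]
      trans if r b (t a) then 1 else 0
      · simp only [Matrix.of_apply, h1 _ b, mul_boole, Finset.sum_ite_eq', Finset.mem_univ,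
          if_true, h2 a b]
      · simp only [Matrix.transpose_apply, Matrix.of_apply, boole_mul, Finset.sum_ite_eq,
          Finset.mem_univ, if_true]
    flip_sq := by
      ext a b
      simp only [Matrix.mul_apply, Matrix.of_apply, boole_mul, Finset.sum_ite_eq,
        Finset.mem_univ, if_true, Matrix.one_apply, ht] }

section ofRel

variable {α : Type u} [Finite α] {r : α → α → Prop} {t : α → α}
  {ht : ∀ a, t (t a) = a} {hr : ∀ a b, r a b → r (t b) (t a)}

theorem ofRel_A (a b : α) : (ofRel r t ht hr).A a b = 1 ↔ r a b := by
  simp [ofRel]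

theorem ofRel_tau (a : α) : (ofRel r t ht hr).tau a = t a :=
  ((ofRel r t ht hr).J_eq_one_iff a (t a)).1 (by simp [ofRel])

end ofRel

/-! ### Half elementary equivalences as relations -/

/-- The relational form of a half elementary equivalence. -/
structure HalfRel (P Q : FlipPair.{u}) (D : P.Alphabet → Q.Alphabet → Prop) : Prop where
  left : ∀ a a', P.A a a' = 1 ↔ ∃ b, D a b ∧ D (P.tau a') (Q.tau b)
  left_unique : ∀ a a' b b', D a b → D (P.tau a') (Q.tau b) → D a b' → D (P.tau a') (Q.tau b') →
    b = b'
  right : ∀ b b', Q.A b b' = 1 ↔ ∃ a, D (P.tau a) (Q.tau b) ∧ D a b'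
  right_unique : ∀ b b' a a', D (P.tau a) (Q.tau b) → D a b' → D (P.tau a') (Q.tau b) → D a' b' →
    a = a'

/-- Since `J` and `K` are involutions, `E = K Dᵀ J` gives `D = J Eᵀ K`, so `D` and `E` play
symmetric roles. -/
theorem HalfRel.symm {P Q : FlipPair.{u}} {D : P.Alphabet → Q.Alphabet → Prop}
    (h : HalfRel P Q D) : HalfRel Q P fun b a => D (P.tau a) (Q.tau b) where
  left b b' := by simpa [tau_tau] using h.right b b'
  left_unique b b' a a' := by simpa only [tau_tau] using h.right_unique b b' a a'
  right a a' := by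
    rw [h.left]
    simp only [tau_tau]
  right_unique a a' b b' h1 h2 h3 h4 := by
    simp only [tau_tau] at h1 h3
    exact h.left_unique a a' b b' h1 h2 h3 h4

theorem flip_mul_transpose_apply {P Q : FlipPair.{u}} (D : Matrix P.Alphabet Q.Alphabet ℕ)
    (b : Q.Alphabet) (a : P.Alphabet) :
    (Q.J * D.transpose * P.J) b a = D (P.tau a) (Q.tau b) := by
  have h1 : ∀ a b, P.tau a = b ↔ a = P.tau b := fun a b =>
    ⟨fun h => by rw [← h, tau_tau], fun h => by rw [h, tau_tau]⟩
  simp [Matrix.mul_apply, J_apply, h1]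

theorem sum_eq_ite {ι : Type*} [Fintype ι] (p : ι → Prop) [DecidablePred p]
    (hp : ∀ i j, p i → p j → i = j) [Decidable (∃ i, p i)] :
    (∑ i, if p i then 1 else 0) = if ∃ i, p i then 1 else 0 := by
  split_ifs with h
  · obtain ⟨i, hi⟩ := h
    rw [Finset.sum_eq_single i]
    · rw [if_pos hi]
    · intro j _ hj
      exact if_neg fun h => hj (hp j i h hi)
    · simp
  · push Not at h
    simp [h]

theorem HalfRel.exists_isHalfElementary {P Q : FlipPair.{u}}
    {D : P.Alphabet → Q.Alphabet → Prop} (h : HalfRel P Q D) :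
    ∃ D E, IsHalfElementary P Q D E := by
  classical
  let M : Matrix P.Alphabet Q.Alphabet ℕ := fun a b => if D a b then 1 else 0
  have hM : M.IsZeroOne := fun a b => by
    by_cases hD : D a b <;> simp [M, hD]
  have hE : ∀ b a, (Q.J * M.transpose * P.J) b a =
      if D (P.tau a) (Q.tau b) then 1 else 0 := fun b a => flip_mul_transpose_apply M b a
  have hA : ∀ (R : FlipPair.{u}) a b, R.A a b = if R.A a b = 1 then 1 else 0 := fun R a b => by
    rcases R.zeroOne_A a b with h | h <;> simp [h]
  refine ⟨M, Q.J * M.transpose * P.J, hM, fun b a => ?_, ?_, ?_, rfl⟩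
  · rw [flip_mul_transpose_apply]
    exact hM _ _
  · ext a a'
    rw [Matrix.mul_apply, hA]
    simp only [hE, M, ← ite_and, mul_ite, mul_one, mul_zero, h.left]
    have := sum_eq_ite (fun b => D (P.tau a') (Q.tau b) ∧ D a b)
      fun b b' h1 h2 => h.left_unique a a' b b' h1.2 h1.1 h2.2 h2.1
    rw [this]
    simp only [and_comm]
  · ext b b'
    rw [Matrix.mul_apply, hA]
    simp only [hE, M, ← ite_and, mul_ite, mul_one, mul_zero, h.right]
    have := sum_eq_ite (fun a => D a b' ∧ D (P.tau a) (Q.tau b))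
      fun a a' h1 h2 => h.right_unique b b' a a' h1.2 h1.1 h2.2 h2.1
    rw [this]
    simp only [and_comm]

theorem eq_of_sum_eq_one {ι : Type*} [Fintype ι] {f g : ι → ℕ} (h : ∑ i, f i * g i ≤ 1) {i j : ι}
    (hi : f i = 1) (hi' : g i = 1) (hj : f j = 1) (hj' : g j = 1) : i = j := by
  classical
  by_contra hne
  have := Finset.sum_le_sum_of_subset (f := fun i => f i * g i) (Finset.subset_univ {i, j})
  rw [Finset.sum_pair hne, hi, hi', hj, hj'] at this
  omega

theorem sum_eq_one_iff {ι : Type*} [Fintype ι] {f g : ι → ℕ} (h : ∑ i, f i * g i ≤ 1)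
    (hf : ∀ i, f i = 0 ∨ f i = 1) (hg : ∀ i, g i = 0 ∨ g i = 1) :
    ∑ i, f i * g i = 1 ↔ ∃ i, f i = 1 ∧ g i = 1 := by
  constructor
  · intro h1
    obtain ⟨i, -, hi⟩ := Finset.exists_ne_zero_of_sum_ne_zero (h1.trans_ne one_ne_zero)
    exact ⟨i, (hf i).resolve_left (left_ne_zero_of_mul hi),
      (hg i).resolve_left (right_ne_zero_of_mul hi)⟩
  · rintro ⟨i, hi, hi'⟩
    have := Finset.single_le_sum (f := fun i => f i * g i) (fun _ _ => Nat.zero_le _)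
      (Finset.mem_univ i)
    simp only [hi, hi'] at this
    omega

/-- The uniqueness clauses come from `A` and `B` being zero-one: each entry of `D * E` or `E * D`
counts intermediate letters, and the count is at most one. -/
theorem IsHalfElementary.halfRel {P Q : FlipPair.{u}} {D : Matrix P.Alphabet Q.Alphabet ℕ}
    {E : Matrix Q.Alphabet P.Alphabet ℕ} (h : IsHalfElementary P Q D E) :
    HalfRel P Q fun a b => D a b = 1 := by
  have hE : ∀ b a, E b a = D (P.tau a) (Q.tau b) := fun b a => by
    rw [h.flip_eq, flip_mul_transpose_apply]
  have hle : ∀ (R : FlipPair.{u}) a b, R.A a b ≤ 1 := fun R a b => by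
    rcases R.zeroOne_A a b with h | h <;> simp [h]
  have hl : ∀ a a', ∑ b, D a b * E b a' ≤ 1 := fun a a' => by
    rw [← Matrix.mul_apply, ← h.left_eq]
    exact hle P a a'
  have hr : ∀ b b', ∑ a, E b a * D a b' ≤ 1 := fun b b' => by
    rw [← Matrix.mul_apply, ← h.right_eq]
    exact hle Q b b'
  refine ⟨fun a a' => ?_, fun a a' b b' h1 h2 h3 h4 => ?_, fun b b' => ?_,
    fun b b' a a' h1 h2 h3 h4 => ?_⟩
  · rw [h.left_eq, Matrix.mul_apply,
      sum_eq_one_iff (hl a a') (h.zeroOne_D a) (fun b => h.zeroOne_E b a')]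
    simp only [hE]
  · rw [← hE] at h2 h4
    exact eq_of_sum_eq_one (hl a a') h1 h2 h3 h4
  · rw [h.right_eq, Matrix.mul_apply,
      sum_eq_one_iff (hr b b') (h.zeroOne_E b) (fun a => h.zeroOne_D a b')]
    simp only [hE]
  · rw [← hE] at h1 h3
    exact eq_of_sum_eq_one (hr b b') h1 h2 h3 h4

/-! ### The two-block code of a half elementary equivalence -/

namespace HalfRel

variable {P Q : FlipPair.{u}} {D : P.Alphabet → Q.Alphabet → Prop}

/-- The letter of `Q` that a half elementary equivalence assigns to an edge of `P`. -/
noncomputable def edgeMap (h : HalfRel P Q D)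
    (e : {e : P.Alphabet × P.Alphabet // P.A e.1 e.2 = 1}) : Q.Alphabet :=
  Classical.choose ((h.left _ _).1 e.2)

theorem edgeMap_spec (h : HalfRel P Q D)
    (e : {e : P.Alphabet × P.Alphabet // P.A e.1 e.2 = 1}) :
    D e.1.1 (h.edgeMap e) ∧ D (P.tau e.1.2) (Q.tau (h.edgeMap e)) :=
  Classical.choose_spec ((h.left _ _).1 e.2)

/-- The two-block code defined by a half elementary equivalence. -/
noncomputable def code (h : HalfRel P Q D) (x : P.shiftSpace) : Q.shiftSpace :=
  ⟨fun i => h.edgeMap ⟨(x.1 i, x.1 (i + 1)), x.2 i⟩, fun i =>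
    (h.right _ _).2 ⟨x.1 (i + 1), (h.edgeMap_spec ⟨(x.1 i, x.1 (i + 1)), x.2 i⟩).2,
      (h.edgeMap_spec ⟨(x.1 (i + 1), x.1 (i + 1 + 1)), x.2 (i + 1)⟩).1⟩⟩

theorem code_spec (h : HalfRel P Q D) (x : P.shiftSpace) (i : ℤ) :
    D (x.1 i) ((h.code x).1 i) ∧ D (P.tau (x.1 (i + 1))) (Q.tau ((h.code x).1 i)) :=
  h.edgeMap_spec ⟨(x.1 i, x.1 (i + 1)), x.2 i⟩

theorem code_eq (h : HalfRel P Q D) (x : P.shiftSpace) (i : ℤ) {b : Q.Alphabet}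
    (h1 : D (x.1 i) b) (h2 : D (P.tau (x.1 (i + 1))) (Q.tau b)) : (h.code x).1 i = b :=
  h.left_unique _ _ _ _ (h.code_spec x i).1 (h.code_spec x i).2 h1 h2

theorem continuous_code (h : HalfRel P Q D) : Continuous h.code := by
  refine Continuous.subtype_mk (continuous_pi fun i => ?_) _
  refine (continuous_of_discreteTopology (f := h.edgeMap)).comp (Continuous.subtype_mk ?_ _)
  exact ((continuous_apply i).comp continuous_subtype_val).prodMk
    ((continuous_apply (i + 1)).comp continuous_subtype_val)

theorem code_translate (h : HalfRel P Q D) (n : ℤ) (x : P.shiftSpace) :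
    h.code (P.translate n x) = Q.translate n (h.code x) := by
  refine Subtype.ext (funext fun i => h.code_eq _ _ (h.code_spec x (i + n)).1 ?_)
  have := (h.code_spec x (i + n)).2
  rwa [add_right_comm] at this

/-- The output letter at `i` sits on the edge `(i, i + 1)`, which is reflected to the edge starting
at `-(i + 1)`; this offset is the source of the twist. -/
theorem code_flipMap (h : HalfRel P Q D) (x : P.shiftSpace) :
    h.code (P.flipMap x) = Q.translate 1 (Q.flipMap (h.code x)) := by
  refine Subtype.ext (funext fun i => h.code_eq _ _ ?_ ?_)
  · have := (h.code_spec x (-(i + 1))).2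
    rwa [show -(i + 1) + 1 = -i by ring] at this
  · change D (P.tau (P.tau _)) (Q.tau (Q.tau _))
    rw [tau_tau, tau_tau]
    exact (h.code_spec x (-(i + 1))).1

/-- Each of the two codes looks one step to the right, so together they advance by half a step each;
the inverse of `code` is therefore `symm.code` shifted back by one. -/
theorem symm_code_code (h : HalfRel P Q D) (x : P.shiftSpace) :
    h.symm.code (h.code x) = P.translate 1 x := by
  refine Subtype.ext (funext fun i => h.symm.code_eq _ _ (h.code_spec x i).2 ?_)
  rw [tau_tau, tau_tau]
  exact (h.code_spec x (i + 1)).1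

theorem code_symm_code (h : HalfRel P Q D) (y : Q.shiftSpace) :
    h.code (h.symm.code y) = Q.translate 1 y := by
  refine Subtype.ext (funext fun i => h.code_eq _ _ ?_ (h.symm.code_spec y (i + 1)).1)
  have := (h.symm.code_spec y i).2
  rwa [tau_tau, tau_tau] at this

theorem conjugate_twist (h : HalfRel P Q D) : P.system.Conjugate Q.system.twist :=
  ⟨{ toFun := h.code
     invFun := fun y => P.translate (-1) (h.symm.code y)
     left_inv := fun x =>
      (congrArg (P.translate (-1)) (h.symm_code_code x)).trans (P.shift.left_inv x)
     right_inv := fun y => ((h.code_translate (-1) _).trans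
      (congrArg (Q.translate (-1)) (h.code_symm_code y))).trans (Q.shift.left_inv y)
     continuous_toFun := h.continuous_code
     continuous_invFun := (P.continuous_translate _).comp h.symm.continuous_code },
   h.code_translate 1, h.code_flipMap⟩

end HalfRel

/-! ### Chains and the parity of the lag -/

theorem StrongShiftEquiv.conjugate {l : ℕ} {P Q : FlipPair.{u}} (h : StrongShiftEquiv l P Q) :
    (Even l → P.system.Conjugate Q.system) ∧ (Odd l → P.system.Conjugate Q.system.twist) := by
  induction h with
  | single D E h => exact ⟨fun h => by simp at h, fun _ => h.halfRel.conjugate_twist⟩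
  | cons D E h t ih =>
    have hc := h.halfRel.conjugate_twist
    refine ⟨fun hl => ?_, fun hl => ?_⟩
    · exact (hc.trans (ih.2 (by simpa [parity_simps] using hl)).twist).trans
        (FlipSystem.conjugate_twist_twist _).symm
    · exact hc.trans (ih.1 (by simpa [parity_simps] using hl)).twist

theorem HalfRel.strongShiftEquiv {P Q : FlipPair.{u}} {D : P.Alphabet → Q.Alphabet → Prop}
    (h : HalfRel P Q D) : StrongShiftEquiv 1 P Q := by
  obtain ⟨D, E, h⟩ := h.exists_isHalfElementary
  exact .single D E h

theorem StrongShiftEquiv.trans {l m : ℕ} {P Q R : FlipPair.{u}} (h : StrongShiftEquiv l P Q)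
    (h' : StrongShiftEquiv m Q R) : StrongShiftEquiv (l + m) P R := by
  induction h with
  | single D E h => rw [add_comm]; exact .cons D E h h'
  | cons D E h t ih => rw [add_right_comm]; exact .cons D E h (ih h')

theorem StrongShiftEquiv.symm {l : ℕ} {P Q : FlipPair.{u}} (h : StrongShiftEquiv l P Q) :
    StrongShiftEquiv l Q P := by
  induction h with
  | single D E h => exact h.halfRel.symm.strongShiftEquiv
  | cons D E h t ih =>
    rw [add_comm]
    simpa [add_comm] using ih.trans h.halfRel.symm.strongShiftEquiv

/-- Strong shift equivalence of some even positive lag. -/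
def EvenEquiv (P Q : FlipPair.{u}) : Prop :=
  ∃ l : ℕ, 0 < l ∧ StrongShiftEquiv (2 * l) P Q

theorem EvenEquiv.symm {P Q : FlipPair.{u}} (h : EvenEquiv P Q) : EvenEquiv Q P := by
  obtain ⟨l, hl, h⟩ := h
  exact ⟨l, hl, h.symm⟩

theorem EvenEquiv.trans {P Q R : FlipPair.{u}} (h : EvenEquiv P Q) (h' : EvenEquiv Q R) :
    EvenEquiv P R := by
  obtain ⟨l, hl, h⟩ := h
  obtain ⟨m, hm, h'⟩ := h'
  exact ⟨l + m, by omega, by rw [mul_add]; exact h.trans h'⟩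

theorem EvenEquiv.conjugate {P Q : FlipPair.{u}} (h : EvenEquiv P Q) :
    P.system.Conjugate Q.system := by
  obtain ⟨l, hl, h⟩ := h
  exact h.conjugate.1 (even_two_mul l)

/-! ### Edge pairs and isomorphisms -/

/-- The edge flip pair: letters are the edges of `P`, and consecutive edges may follow each
other. -/
noncomputable def edge (P : FlipPair.{u}) : FlipPair.{u} :=
  ofRel (α := {e : P.Alphabet × P.Alphabet // P.A e.1 e.2 = 1}) (fun e e' => e.1.2 = e'.1.1)
    (fun e => ⟨(P.tau e.1.2, P.tau e.1.1), (P.A_tau _ _).trans e.2⟩)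
    (fun _ => Subtype.ext (Prod.ext (P.tau_tau _) (P.tau_tau _)))
    (fun _ _ h => congrArg P.tau h.symm)

/-- The initial letter of an edge. -/
def edgeSrc (P : FlipPair.{u}) (e : P.edge.Alphabet) : P.Alphabet :=
  Prod.fst (Subtype.val (p := fun e : P.Alphabet × P.Alphabet => P.A e.1 e.2 = 1) e)

/-- The terminal letter of an edge. -/
def edgeTgt (P : FlipPair.{u}) (e : P.edge.Alphabet) : P.Alphabet :=
  Prod.snd (Subtype.val (p := fun e : P.Alphabet × P.Alphabet => P.A e.1 e.2 = 1) e)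

section edge

variable {P : FlipPair.{u}}

theorem edge_A (e e' : P.edge.Alphabet) : P.edge.A e e' = 1 ↔ P.edgeTgt e = P.edgeSrc e' :=
  ofRel_A _ _

theorem edgeSrc_tau (e : P.edge.Alphabet) : P.edgeSrc (P.edge.tau e) = P.tau (P.edgeTgt e) :=
  congrArg P.edgeSrc (ofRel_tau e)

theorem edgeTgt_tau (e : P.edge.Alphabet) : P.edgeTgt (P.edge.tau e) = P.tau (P.edgeSrc e) :=
  congrArg P.edgeTgt (ofRel_tau e)

theorem edge_ext {e e' : P.edge.Alphabet} (h : P.edgeSrc e = P.edgeSrc e')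
    (h' : P.edgeTgt e = P.edgeTgt e') : e = e' :=
  Subtype.ext (Prod.ext h h')

theorem edge_adj (e : P.edge.Alphabet) : P.A (P.edgeSrc e) (P.edgeTgt e) = 1 :=
  Subtype.property (p := fun e : P.Alphabet × P.Alphabet => P.A e.1 e.2 = 1) e

theorem exists_edge {a b : P.Alphabet} (h : P.A a b = 1) :
    ∃ e, P.edgeSrc e = a ∧ P.edgeTgt e = b :=
  ⟨(⟨(a, b), h⟩ : {e : P.Alphabet × P.Alphabet // P.A e.1 e.2 = 1}), rfl, rfl⟩

end edge

/-- Here `D` records initial letters and `E` terminal letters: `D * E` counts edges between two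
letters, and `E * D` tests whether two edges are composable. -/
theorem halfRel_edge (P : FlipPair.{u}) : HalfRel P P.edge fun a e => P.edgeSrc e = a where
  left a a' := by
    simp only [edgeSrc_tau, P.tau_injective.eq_iff]
    refine ⟨exists_edge, ?_⟩
    rintro ⟨e, rfl, rfl⟩
    exact edge_adj e
  left_unique a a' e e' h1 h2 h3 h4 := by
    simp only [edgeSrc_tau, P.tau_injective.eq_iff] at h2 h4
    exact edge_ext (h1.trans h3.symm) (h2.trans h4.symm)
  right e e' := by
    simp only [edgeSrc_tau, P.tau_injective.eq_iff, edge_A]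
    exact ⟨fun h => ⟨_, rfl, h.symm⟩, fun ⟨_, h, h'⟩ => h.trans h'.symm⟩
  right_unique e e' a a' _ h1 _ h2 := h1.symm.trans h2

/-- A flip pair `Q` is isomorphic to `P` through the bijection `f`. -/
structure IsIso (P Q : FlipPair.{u}) (f : P.Alphabet ≃ Q.Alphabet) : Prop where
  adj : ∀ a b, Q.A (f a) (f b) = 1 ↔ P.A a b = 1
  tau : ∀ a, f (P.tau a) = Q.tau (f a)

theorem IsIso.halfRel {P Q R : FlipPair.{u}} {f : P.Alphabet ≃ Q.Alphabet} (hf : IsIso P Q f)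
    {D : P.Alphabet → R.Alphabet → Prop} (h : HalfRel P R D) :
    HalfRel Q R fun a b => D (f.symm a) b := by
  have htau : ∀ a, f.symm (Q.tau a) = P.tau (f.symm a) := fun a => by
    rw [f.symm_apply_eq, hf.tau, f.apply_symm_apply]
  refine ⟨fun a a' => ?_, fun a a' b b' => ?_, fun b b' => ?_, fun b b' a a' => ?_⟩
  · have := hf.adj (f.symm a) (f.symm a')
    rw [f.apply_symm_apply, f.apply_symm_apply] at this
    rw [this, h.left]
    simp only [htau]
  · rw [htau]
    exact h.left_unique _ _ _ _
  · rw [h.right]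
    refine ⟨fun ⟨a, ha⟩ => ⟨f a, ?_⟩, fun ⟨a, ha⟩ => ⟨f.symm a, ?_⟩⟩
    · rwa [htau, f.symm_apply_apply]
    · rwa [htau] at ha
  · rw [htau, htau]
    exact fun h1 h2 h3 h4 => f.symm.injective (h.right_unique _ _ _ _ h1 h2 h3 h4)

/-- Both pairs have a half elementary equivalence to `P.edge`; one is followed forwards and the
other backwards. -/
theorem IsIso.evenEquiv {P Q : FlipPair.{u}} {f : P.Alphabet ≃ Q.Alphabet} (hf : IsIso P Q f) :
    EvenEquiv P Q :=
  ⟨1, one_pos, P.halfRel_edge.strongShiftEquiv.trans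
    (hf.halfRel P.halfRel_edge).strongShiftEquiv.symm⟩

theorem EvenEquiv.refl (P : FlipPair.{u}) : EvenEquiv P P :=
  IsIso.evenEquiv (f := Equiv.refl _) ⟨fun _ _ => Iff.rfl, fun _ => rfl⟩

/-! ### Splitting letters by the labels of their neighbours -/

/-- A labelling of the letters by a finite set on which the flip induces an involution. -/
structure Labelling (P : FlipPair.{u}) where
  Label : Type u
  [finite : Finite Label]
  toFun : P.Alphabet → Label
  flip : Label → Label
  flip_flip : ∀ b, flip (flip b) = b
  map_tau : ∀ a, toFun (P.tau a) = flip (toFun a)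

attribute [instance] Labelling.finite

/-- Letters of `P` together with the labels of a predecessor and of a successor. -/
def SplitLetter {P : FlipPair.{u}} (f : P.Labelling) : Type u :=
  {s : f.Label × P.Alphabet × f.Label //
    ∃ a c, P.A a s.2.1 = 1 ∧ P.A s.2.1 c = 1 ∧ f.toFun a = s.1 ∧ f.toFun c = s.2.2}

instance {P : FlipPair.{u}} (f : P.Labelling) : Finite (SplitLetter f) :=
  inferInstanceAs (Finite {s : f.Label × P.Alphabet × f.Label //
    ∃ a c, P.A a s.2.1 = 1 ∧ P.A s.2.1 c = 1 ∧ f.toFun a = s.1 ∧ f.toFun c = s.2.2})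

/-- The flip pair obtained by splitting each letter according to the labels of its predecessors
and successors. -/
noncomputable def split {P : FlipPair.{u}} (f : P.Labelling) : FlipPair.{u} :=
  ofRel (α := SplitLetter f)
    (fun s s' => P.A s.1.2.1 s'.1.2.1 = 1 ∧ s.1.2.2 = f.toFun s'.1.2.1 ∧
      s'.1.1 = f.toFun s.1.2.1)
    (fun s => ⟨(f.flip s.1.2.2, P.tau s.1.2.1, f.flip s.1.1), by
      obtain ⟨a, c, h1, h2, h3, h4⟩ := s.2
      refine ⟨P.tau c, P.tau a, ?_, ?_, ?_, ?_⟩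
      · rwa [A_tau]
      · rwa [A_tau]
      · rw [f.map_tau, h4]
      · rw [f.map_tau, h3]⟩)
    (fun s => Subtype.ext (Prod.ext (f.flip_flip _) (Prod.ext (P.tau_tau _) (f.flip_flip _))))
    (fun s s' h => by
      refine ⟨?_, ?_, ?_⟩
      · rw [A_tau]; exact h.1
      · exact (congrArg f.flip h.2.2).trans (f.map_tau _).symm
      · exact (congrArg f.flip h.2.1).trans (f.map_tau _).symm)

section split

variable {P : FlipPair.{u}} {f : P.Labelling}

/-- The underlying letter of a letter of `split f`. -/
def mid (s : (split f).Alphabet) : P.Alphabet := (show SplitLetter f from s).1.2.1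

/-- The label of the predecessors of a letter of `split f`. -/
def lft (s : (split f).Alphabet) : f.Label := (show SplitLetter f from s).1.1

/-- The label of the successors of a letter of `split f`. -/
def rgt (s : (split f).Alphabet) : f.Label := (show SplitLetter f from s).1.2.2

theorem split_A (s s' : (split f).Alphabet) : (split f).A s s' = 1 ↔
    P.A (mid s) (mid s') = 1 ∧ rgt s = f.toFun (mid s') ∧ lft s' = f.toFun (mid s) :=
  ofRel_A _ _

theorem mid_tau (s : (split f).Alphabet) : mid ((split f).tau s) = P.tau (mid s) :=
  congrArg mid (ofRel_tau s)

theorem lft_tau (s : (split f).Alphabet) : lft ((split f).tau s) = f.flip (rgt s) :=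
  congrArg lft (ofRel_tau s)

theorem rgt_tau (s : (split f).Alphabet) : rgt ((split f).tau s) = f.flip (lft s) :=
  congrArg rgt (ofRel_tau s)

theorem split_ext {s s' : (split f).Alphabet} (hl : lft s = lft s') (hm : mid s = mid s')
    (hr : rgt s = rgt s') : s = s' :=
  Subtype.ext (Prod.ext hl (Prod.ext hm hr))

theorem split_spec (s : (split f).Alphabet) : ∃ a c, P.A a (mid s) = 1 ∧ P.A (mid s) c = 1 ∧
    f.toFun a = lft s ∧ f.toFun c = rgt s :=
  (show SplitLetter f from s).2

theorem exists_split {a b c : P.Alphabet} (h : P.A a b = 1) (h' : P.A b c = 1) :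
    ∃ s : (split f).Alphabet, mid s = b ∧ lft s = f.toFun a ∧ rgt s = f.toFun c :=
  ⟨(⟨(f.toFun a, b, f.toFun c), a, c, h, h', rfl, rfl⟩ : SplitLetter f), rfl, rfl, rfl⟩

theorem Labelling.flip_injective (f : P.Labelling) : Function.Injective f.flip :=
  Function.LeftInverse.injective f.flip_flip

end split

/-- A path `a → b → c`, seen as two composable edges, passes through the single split letter `(f a,
b, f c)`. Conversely, a transition between split letters passes through the single edge joining
their middle letters. -/
theorem halfRel_split {P : FlipPair.{u}} (f : P.Labelling) :
    HalfRel P.edge (split f)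
      fun e s => mid s = P.edgeTgt e ∧ lft s = f.toFun (P.edgeSrc e) := by
  have htau : ∀ e s, (mid ((split f).tau s) = P.edgeTgt (P.edge.tau e) ∧
      lft ((split f).tau s) = f.toFun (P.edgeSrc (P.edge.tau e))) ↔
      mid s = P.edgeSrc e ∧ rgt s = f.toFun (P.edgeTgt e) := fun e s => by
    rw [mid_tau, lft_tau, edgeTgt_tau, edgeSrc_tau, f.map_tau, P.tau_injective.eq_iff,
      f.flip_injective.eq_iff]
  refine ⟨fun e e' => ?_, fun e e' s s' h1 h2 h3 h4 => ?_, fun s s' => ?_,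
    fun s s' e e' h1 h2 h3 h4 => ?_⟩
  · simp only [htau]
    rw [edge_A]
    constructor
    · intro h
      obtain ⟨s, hm, hl, hr⟩ := exists_split (f := f) (edge_adj e) (h ▸ edge_adj e')
      exact ⟨s, ⟨hm, hl⟩, hm.trans h, hr⟩
    · rintro ⟨s, ⟨h1, -⟩, h2, -⟩
      exact h1.symm.trans h2
  · rw [htau] at h2 h4
    exact split_ext (h1.2.trans h3.2.symm) (h1.1.trans h3.1.symm) (h2.2.trans h4.2.symm)
  · simp only [htau]
    rw [split_A]
    constructor
    · rintro ⟨h1, h2, h3⟩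
      obtain ⟨e, he, he'⟩ := exists_edge h1
      refine ⟨e, ⟨he.symm, ?_⟩, he'.symm, ?_⟩
      · rw [he', h2]
      · rw [he, h3]
    · rintro ⟨e, ⟨h1, h2⟩, h3, h4⟩
      rw [h1, h2, h3, h4]
      exact ⟨edge_adj e, rfl, rfl⟩
  · rw [htau] at h1 h3
    exact edge_ext (h1.1.symm.trans h3.1) (h2.1.symm.trans h4.1)

theorem evenEquiv_split {P : FlipPair.{u}} (f : P.Labelling) : EvenEquiv P (split f) :=
  ⟨1, one_pos, P.halfRel_edge.strongShiftEquiv.trans (halfRel_split f).strongShiftEquiv⟩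

/-! ### Reduction to essential flip pairs -/

/-- Every letter has a predecessor and a successor. -/
def IsEssential (P : FlipPair.{u}) : Prop :=
  ∀ a, (∃ b, P.A b a = 1) ∧ ∃ c, P.A a c = 1

theorem IsEssential.split {P : FlipPair.{u}} (hP : P.IsEssential) (f : P.Labelling) :
    (split f).IsEssential := by
  intro s
  obtain ⟨a, c, h1, h2, h3, h4⟩ := split_spec s
  obtain ⟨a', ha'⟩ := (hP a).1
  obtain ⟨c', hc'⟩ := (hP c).2
  obtain ⟨s1, hm1, hl1, hr1⟩ := exists_split (f := f) ha' h1
  obtain ⟨s2, hm2, hl2, hr2⟩ := exists_split (f := f) h2 hc'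
  refine ⟨⟨s1, ?_⟩, s2, ?_⟩
  · rw [split_A, hm1, hr1, h3]
    exact ⟨h1, rfl, rfl⟩
  · rw [split_A, hm2, hl2, h4]
    exact ⟨h2, rfl, rfl⟩

/-- The labelling with a single label. -/
def Labelling.trivial (P : FlipPair.{u}) : P.Labelling where
  Label := PUnit
  toFun _ := PUnit.unit
  flip := id
  flip_flip _ := rfl
  map_tau _ := rfl

/-- With one label, splitting merely deletes the letters lacking a predecessor or a successor. This
may strand others, hence the induction on the number of letters. -/
theorem exists_essential (P : FlipPair.{u}) : ∃ Q, EvenEquiv P Q ∧ Q.IsEssential := by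
  induction hn : Nat.card P.Alphabet using Nat.strong_induction_on generalizing P with
  | _ n ih =>
    by_cases hP : P.IsEssential
    · exact ⟨P, .refl P, hP⟩
    let f := Labelling.trivial P
    have hinj : Function.Injective (mid (f := f)) := fun s s' h => split_ext rfl h rfl
    have hlt : Nat.card (FlipPair.split f).Alphabet < n := by
      rw [← hn]
      refine lt_of_le_of_ne (Nat.card_le_card_of_injective _ hinj) fun h => hP fun a => ?_
      obtain ⟨s, rfl⟩ :=
        (((Nat.bijective_iff_injective_and_card (mid (f := f))).2 ⟨hinj, h⟩).2) a
      obtain ⟨a, c, h1, h2, -⟩ := split_spec s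
      exact ⟨⟨a, h1⟩, c, h2⟩
    obtain ⟨Q, h, hQ⟩ := ih _ hlt _ rfl
    exact ⟨Q, (evenEquiv_split f).trans h, hQ⟩

theorem IsEssential.exists_point {P : FlipPair.{u}} (hP : P.IsEssential) {a b : P.Alphabet}
    (h : P.A a b = 1) : ∃ x : P.shiftSpace, x.1 0 = a ∧ x.1 1 = b := by
  choose p hp using fun a => (hP a).1
  choose n hn using fun a => (hP a).2
  refine ⟨⟨fun i => if 0 < i then n^[(i - 1).toNat] b else p^[(-i).toNat] a, fun i => ?_⟩, ?_, ?_⟩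
  · dsimp only
    rcases lt_trichotomy i 0 with hi | rfl | hi
    · rw [if_neg (by omega), if_neg (by omega),
        show (-i).toNat = (-(i + 1)).toNat + 1 by omega, Function.iterate_succ_apply']
      exact hp _
    · simpa using h
    · rw [if_pos hi, if_pos (by omega),
        show (i + 1 - 1).toNat = (i - 1).toNat + 1 by omega, Function.iterate_succ_apply']
      exact hn _
  · simp
  · simp

/-! ### Partitions of a common system and their refinements -/

/-- A map from a flip system to a topological Markov chain commuting with the shifts and the
flips (not necessarily continuous). -/
structure IsFactor (S : FlipSystem.{u}) (P : FlipPair.{u}) (ψ : S.X → P.shiftSpace) : Prop where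
  shift : ∀ x i, (ψ (S.T x)).1 i = (ψ x).1 (i + 1)
  flip : ∀ x i, (ψ (S.F x)).1 i = P.tau ((ψ x).1 (-i))

section factor

variable {S : FlipSystem.{u}} {P Q : FlipPair.{u}} {ψ : S.X → P.shiftSpace}

theorem IsFactor.shift_symm (h : IsFactor S P ψ) (x : S.X) (i : ℤ) :
    (ψ (S.T.symm x)).1 i = (ψ x).1 (i - 1) := by
  have := h.shift (S.T.symm x) (i - 1)
  rw [S.T.apply_symm_apply] at this
  rw [this, sub_add_cancel]

theorem exists_apply_zero_eq (hP : P.IsEssential) (hs : Function.Surjective ψ)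
    (a : P.Alphabet) : ∃ x, (ψ x).1 0 = a := by
  obtain ⟨b, hb⟩ := (hP a).2
  obtain ⟨y, hy, -⟩ := hP.exists_point hb
  obtain ⟨x, rfl⟩ := hs y
  exact ⟨x, hy⟩

/-- Essential flip pairs covered by the same system with the same partition are isomorphic. -/
theorem evenEquiv_of_same_kernel {η : S.X → Q.shiftSpace} (hP : P.IsEssential)
    (hQ : Q.IsEssential) (hψ : IsFactor S P ψ) (hη : IsFactor S Q η)
    (hψs : Function.Surjective ψ) (hηs : Function.Surjective η)
    (h : ∀ x y, (ψ x).1 0 = (ψ y).1 0 ↔ (η x).1 0 = (η y).1 0) : EvenEquiv P Q := by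
  choose g hg using exists_apply_zero_eq hP hψs
  choose k hk using exists_apply_zero_eq hQ hηs
  -- Equality of partitions makes the symbol map independent of the chosen points `g a` and `k b`.
  have key : ∀ x, (η (g ((ψ x).1 0))).1 0 = (η x).1 0 := fun x => (h _ _).1 (hg _)
  have key' : ∀ x, (ψ (k ((η x).1 0))).1 0 = (ψ x).1 0 := fun x => (h _ _).2 (hk _)
  let f : P.Alphabet ≃ Q.Alphabet :=
    { toFun := fun a => (η (g a)).1 0
      invFun := fun b => (ψ (k b)).1 0
      left_inv := fun a => (key' _).trans (hg a)
      right_inv := fun b => (key _).trans (hk b) }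
  have hf : ∀ x i, f ((ψ x).1 i) = (η x).1 i := by
    have h0 : ∀ x, f ((ψ x).1 0) = (η x).1 0 := key
    intro x i
    -- Moving `x` along its orbit reduces every coordinate to coordinate 0.
    induction i using Int.induction_on generalizing x with
    | zero => exact h0 x
    | succ i ih => rw [← hψ.shift, ← hη.shift, ih]
    | pred i ih => rw [← hψ.shift_symm, ← hη.shift_symm, ih]
  refine IsIso.evenEquiv (f := f) ⟨fun a b => ⟨fun hab => ?_, fun hab => ?_⟩, fun a => ?_⟩
  -- Essentiality is used here: every edge is seen in some point, and points of one chain are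
  -- carried letter by letter to points of the other.
  · obtain ⟨y, hy, hy'⟩ := hQ.exists_point hab
    obtain ⟨x, rfl⟩ := hηs y
    rw [← hf, f.injective.eq_iff] at hy hy'
    rw [← hy, ← hy']
    exact (ψ x).2 0
  · obtain ⟨y, hy, hy'⟩ := hP.exists_point hab
    obtain ⟨x, rfl⟩ := hψs y
    rw [← hy, ← hy', hf, hf]
    exact (η x).2 0
  · have h1 := hψ.flip (g a) 0
    have h2 := hη.flip (g a) 0
    rw [neg_zero] at h1 h2
    rw [← hf, ← hf, h1, hg] at h2
    exact h2

/-- The code from the chain of `P` to that of `split f`. -/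
def splitCode (f : P.Labelling) (x : P.shiftSpace) : (split f).shiftSpace :=
  ⟨fun i => (⟨(f.toFun (x.1 (i - 1)), x.1 i, f.toFun (x.1 (i + 1))), x.1 (i - 1), x.1 (i + 1),
      by simpa using x.2 (i - 1), x.2 i, rfl, rfl⟩ : SplitLetter f), fun i =>
    (split_A _ _).2 ⟨x.2 i, rfl,
      congrArg (fun j => f.toFun (x.1 j)) (add_sub_cancel_right i 1)⟩⟩

theorem mid_splitCode (f : P.Labelling) (x : P.shiftSpace) (i : ℤ) :
    mid ((splitCode f x).1 i) = x.1 i := rfl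

theorem lft_splitCode (f : P.Labelling) (x : P.shiftSpace) (i : ℤ) :
    lft ((splitCode f x).1 i) = f.toFun (x.1 (i - 1)) := rfl

theorem rgt_splitCode (f : P.Labelling) (x : P.shiftSpace) (i : ℤ) :
    rgt ((splitCode f x).1 i) = f.toFun (x.1 (i + 1)) := rfl

theorem splitCode_surjective (f : P.Labelling) : Function.Surjective (splitCode f) := by
  intro z
  have hz := fun i => (split_A _ _).1 (z.2 i)
  refine ⟨⟨fun i => mid (z.1 i), fun i => (hz i).1⟩, Subtype.ext (funext fun i => ?_)⟩
  refine split_ext ?_ rfl ?_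
  · have := (hz (i - 1)).2.2
    rw [sub_add_cancel] at this
    rw [this, lft_splitCode]
  · rw [(hz i).2.1, rgt_splitCode]

theorem IsFactor.splitCode (h : IsFactor S P ψ) (f : P.Labelling) :
    IsFactor S (split f) fun x => splitCode f (ψ x) := by
  refine ⟨fun x i => split_ext ?_ ?_ ?_, fun x i => split_ext ?_ ?_ ?_⟩
  · simp only [lft_splitCode, h.shift, sub_add_cancel, add_sub_cancel_right]
  · simp only [mid_splitCode, h.shift]
  · simp only [rgt_splitCode, h.shift]
  · rw [lft_tau, lft_splitCode, rgt_splitCode, h.flip, f.map_tau, neg_sub, neg_add_eq_sub]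
  · rw [mid_tau, mid_splitCode, mid_splitCode, h.flip]
  · rw [rgt_tau, lft_splitCode, rgt_splitCode, h.flip, f.map_tau, neg_add, sub_eq_add_neg]

/-- As `r` is coarser than the partition by the zeroth symbol, its classes label the letters; as `F`
preserves `r`, the flip acts on the labels. Splitting then records the `r`-classes of `T⁻¹ x` and `T
x`. -/
theorem exists_split_cover (hP : P.IsEssential) (hψ : IsFactor S P ψ)
    (hs : Function.Surjective ψ) (r : Setoid S.X)
    (hr : ∀ x y, (ψ x).1 0 = (ψ y).1 0 → r x y) (hF : ∀ x y, r x y → r (S.F x) (S.F y)) :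
    ∃ (R : FlipPair.{u}) (η : S.X → R.shiftSpace), EvenEquiv P R ∧ R.IsEssential ∧
      IsFactor S R η ∧ Function.Surjective η ∧
      ∀ x y, (η x).1 0 = (η y).1 0 ↔ (ψ x).1 0 = (ψ y).1 0 ∧
        r (S.T.symm x) (S.T.symm y) ∧ r (S.T x) (S.T y) := by
  choose g hg using exists_apply_zero_eq hP hs
  have htau : ∀ a, r (g (P.tau a)) (S.F (g a)) := fun a => hr _ _ <| by
    rw [hg, hψ.flip, neg_zero, hg]
  -- The representatives `g a` do not matter: points sharing a zeroth symbol are `r`-related.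
  let c : Setoid P.Alphabet := r.comap g
  have hc : ∀ x y, (Quotient.mk c ((ψ x).1 0) = Quotient.mk c ((ψ y).1 0) ↔ r x y) := by
    intro x y
    rw [Quotient.eq]
    change r _ _ ↔ _
    have h1 : ∀ x, r (g ((ψ x).1 0)) x := fun x => hr _ _ (hg _)
    exact ⟨fun h => r.trans (r.symm (h1 x)) (r.trans h (h1 y)),
      fun h => r.trans (h1 x) (r.trans h (r.symm (h1 y)))⟩
  let f : P.Labelling :=
    { Label := Quotient c
      toFun := Quotient.mk c
      flip := Quotient.map P.tau fun a b hab =>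
        r.trans (htau a) (r.trans (hF _ _ hab) (r.symm (htau b)))
      flip_flip := by
        rintro ⟨a⟩
        exact congrArg (Quotient.mk c) (P.tau_tau a)
      map_tau := fun a => rfl }
  refine ⟨split f, fun x => FlipPair.splitCode f (ψ x), evenEquiv_split f, hP.split f,
    hψ.splitCode f, (splitCode_surjective f).comp hs, fun x y => ?_⟩
  have e1 : ∀ x, (ψ x).1 (0 - 1) = (ψ (S.T.symm x)).1 0 := fun x => (hψ.shift_symm x 0).symm
  have e2 : ∀ x, (ψ x).1 (0 + 1) = (ψ (S.T x)).1 0 := fun x => (hψ.shift x 0).symm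
  rw [← hc, ← hc, ← e1, ← e1, ← e2, ← e2]
  exact ⟨fun h => ⟨congrArg mid h, congrArg lft h, congrArg rgt h⟩,
    fun h => split_ext h.2.1 h.1 h.2.2⟩

/-- The equivalence relation of having the same window of radius `k`. -/
def window (ψ : S.X → P.shiftSpace) (k : ℕ) : Setoid S.X where
  r x y := ∀ i : ℤ, |i| ≤ k → (ψ x).1 i = (ψ y).1 i
  iseqv := ⟨fun _ _ _ => rfl, fun h i hi => (h i hi).symm,
    fun h h' i hi => (h i hi).trans (h' i hi)⟩

theorem window_apply {k : ℕ} {x y : S.X} :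
    window ψ k x y ↔ ∀ i : ℤ, |i| ≤ k → (ψ x).1 i = (ψ y).1 i := Iff.rfl

theorem window_zero {x y : S.X} : window ψ 0 x y ↔ (ψ x).1 0 = (ψ y).1 0 := by
  rw [window_apply]
  refine ⟨fun h => h 0 (by simp), fun h i hi => ?_⟩
  rw [Nat.cast_zero, abs_nonpos_iff] at hi
  rwa [hi]

theorem window_mono {k l : ℕ} (hkl : k ≤ l) {x y : S.X} (h : window ψ l x y) :
    window ψ k x y := fun i hi => h i (hi.trans (by exact_mod_cast hkl))

theorem IsFactor.window_flip (hψ : IsFactor S P ψ) {k : ℕ} {x y : S.X} (h : window ψ k x y) :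
    window ψ k (S.F x) (S.F y) := fun i hi => by
  rw [hψ.flip, hψ.flip, h (-i) (by rwa [abs_neg])]

theorem IsFactor.window_succ (hψ : IsFactor S P ψ) {k : ℕ} {x y : S.X} :
    window ψ (k + 1) x y ↔ window ψ k x y ∧ window ψ k (S.T.symm x) (S.T.symm y) ∧
      window ψ k (S.T x) (S.T y) := by
  simp only [window_apply, hψ.shift, hψ.shift_symm]
  refine ⟨fun h => ⟨fun i hi => h i ?_, fun i hi => h _ ?_, fun i hi => h _ ?_⟩,
    fun ⟨h0, h1, h2⟩ i hi => ?_⟩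
  · push_cast
    omega
  · push_cast
    rw [abs_le] at hi ⊢
    omega
  · push_cast
    rw [abs_le] at hi ⊢
    omega
  · push_cast at hi
    rw [abs_le] at hi
    rcases lt_trichotomy i 0 with h | rfl | h
    · simpa using h1 (i + 1) (abs_le.2 (by omega))
    · exact h0 0 (by simp)
    · simpa using h2 (i - 1) (abs_le.2 (by omega))

/-- Each splitting by the current `η`-window widens it by one on both sides. The hypothesis `hr`
starts the induction, since a window of radius 0 must already be determined by the letter. -/
theorem exists_window_cover {η : S.X → Q.shiftSpace} (hP : P.IsEssential)
    (hψ : IsFactor S P ψ) (hs : Function.Surjective ψ) (hη : IsFactor S Q η)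
    (hr : ∀ x y, (ψ x).1 0 = (ψ y).1 0 → (η x).1 0 = (η y).1 0) (k : ℕ) :
    ∃ (R : FlipPair.{u}) (ξ : S.X → R.shiftSpace), EvenEquiv P R ∧ R.IsEssential ∧
      IsFactor S R ξ ∧ Function.Surjective ξ ∧
      ∀ x y, (ξ x).1 0 = (ξ y).1 0 ↔ (ψ x).1 0 = (ψ y).1 0 ∧ window η k x y := by
  induction k with
  | zero =>
    refine ⟨P, ψ, .refl P, hP, hψ, hs, fun x y => ?_⟩
    rw [window_zero]
    exact ⟨fun h => ⟨h, hr _ _ h⟩, fun h => h.1⟩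
  | succ k ih =>
    obtain ⟨R, ξ, hR, hRe, hξ, hξs, hk⟩ := ih
    obtain ⟨R', ξ', hR', hRe', hξ', hξs', hk'⟩ := exists_split_cover hRe hξ hξs (window η k)
      (fun x y h => ((hk x y).1 h).2) (fun x y h => hη.window_flip h)
    refine ⟨R', ξ', hR.trans hR', hRe', hξ', hξs', fun x y => ?_⟩
    rw [hk', hk, hη.window_succ, and_assoc]

end factor

/-! ### Block codes from compactness, and the conclusion -/

theorem compactSpace_shiftSpace (P : FlipPair.{u}) : CompactSpace P.shiftSpace := by
  rw [← isCompact_iff_compactSpace]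
  refine IsClosed.isCompact ?_
  have : P.shiftSpace = ⋂ i : ℤ, {x | P.A (x i) (x (i + 1)) = 1} := by
    ext x
    simp [shiftSpace]
  rw [this]
  refine isClosed_iInter fun i => ?_
  have hc : Continuous fun x : ℤ → P.Alphabet => (x i, x (i + 1)) :=
    (continuous_apply i).prodMk (continuous_apply (i + 1))
  exact (isClosed_discrete {e : P.Alphabet × P.Alphabet | P.A e.1 e.2 = 1}).preimage hc

/-- A continuous map from a topological Markov chain to a discrete space depends on finitely many
coordinates only. -/
theorem exists_radius {P : FlipPair.{u}} {β : Type*} [TopologicalSpace β] [DiscreteTopology β]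
    {g : P.shiftSpace → β} (hg : Continuous g) :
    ∃ m : ℕ, ∀ x y : P.shiftSpace, (∀ i : ℤ, |i| ≤ m → x.1 i = y.1 i) → g x = g y := by
  have := P.compactSpace_shiftSpace
  have hloc : ∀ x : P.shiftSpace, ∃ m : ℕ, ∀ y : P.shiftSpace,
      (∀ i : ℤ, |i| ≤ m → x.1 i = y.1 i) → g x = g y := by
    intro x
    have hx : g ⁻¹' {g x} ∈ nhds x := hg.continuousAt (by simp)
    rw [nhds_subtype_eq_comap, Filter.mem_comap] at hx
    obtain ⟨t, ht, hsub⟩ := hx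
    rw [nhds_pi, Filter.mem_pi] at ht
    obtain ⟨I, hI, t', ht', hsub'⟩ := ht
    obtain ⟨m, hm⟩ := (hI.image Int.natAbs).bddAbove
    refine ⟨m, fun y hy => ?_⟩
    have : y ∈ g ⁻¹' {g x} := hsub (hsub' fun i hi => by
      have := hm (Set.mem_image_of_mem _ hi)
      rw [← hy i (by rw [Int.abs_eq_natAbs]; exact_mod_cast this)]
      exact mem_of_mem_nhds (ht' i))
    exact (Set.mem_singleton_iff.1 this).symm
  choose m hm using hloc
  let U : P.shiftSpace → Set P.shiftSpace := fun x =>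
    {y | ∀ i ∈ Set.Icc (-(m x : ℤ)) (m x), x.1 i = y.1 i}
  have hU : ∀ x, U x ∈ nhds x := by
    intro x
    have : IsOpen (U x) := by
      have : U x = ⋂ i ∈ Set.Icc (-(m x : ℤ)) (m x), {y : P.shiftSpace | x.1 i = y.1 i} := by
        ext y
        simp [U]
      rw [this]
      refine (Set.finite_Icc _ _).isOpen_biInter fun i _ => ?_
      have hc : Continuous fun y : P.shiftSpace => y.1 i :=
        (continuous_apply i).comp continuous_subtype_val
      exact (isOpen_discrete {a | x.1 i = a}).preimage hc
    exact this.mem_nhds fun _ _ => rfl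
  obtain ⟨t, -, ht⟩ := isCompact_univ.elim_nhds_subcover U fun x _ => hU x
  -- Two points agreeing on this radius lie in the same cylinder of the finite subcover, so both are
  -- compared with its centre `z`.
  refine ⟨t.sup m, fun x y hxy => ?_⟩
  obtain ⟨z, hz, hxz⟩ := Set.mem_iUnion₂.1 (ht (Set.mem_univ x))
  have hle : m z ≤ t.sup m := Finset.le_sup hz
  rw [← hm z x fun i hi => hxz i (abs_le.1 hi), ← hm z y fun i hi => ?_]
  rw [hxz i (abs_le.1 hi)]
  exact hxy i (by omega)

theorem isFactor_id (P : FlipPair.{u}) : IsFactor P.system P id :=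
  ⟨fun _ _ => rfl, fun _ _ => rfl⟩

/-- Choose `m` so that the `ψ`-window of radius `m` determines the zeroth `η`-symbol, and `N` so
that the `η`-window of radius `N` determines that `ψ`-window. Refining `P` first by `ψ` up to `m`
and then by `η` up to `N` gives the same partition as refining `Q` by `η` up to `N`. -/
theorem evenEquiv_of_conjugate_of_essential {P Q : FlipPair.{u}} (hP : P.IsEssential)
    (hQ : Q.IsEssential) (h : P.system.Conjugate Q.system) : EvenEquiv P Q := by
  obtain ⟨θ, hT, hF⟩ := h
  let ψ : P.system.X → P.shiftSpace := id
  have hψ : IsFactor P.system P ψ := P.isFactor_id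
  let η : P.system.X → Q.shiftSpace := θ
  have hη : IsFactor P.system Q η :=
    ⟨fun x i => congrFun (congrArg Subtype.val (hT x)) i,
      fun x i => congrFun (congrArg Subtype.val (hF x)) i⟩
  have hηs : Function.Surjective η := θ.surjective
  obtain ⟨m, hm⟩ : ∃ m : ℕ, ∀ x y, window ψ m x y → (η x).1 0 = (η y).1 0 :=
    exists_radius (P := P) (g := fun x => (η x).1 0)
      (((continuous_apply 0).comp continuous_subtype_val).comp θ.continuous)
  have hn : ∀ i : ℤ, ∃ n : ℕ, ∀ x y, window η n x y → (ψ x).1 i = (ψ y).1 i := fun i => by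
    obtain ⟨n, hn⟩ := exists_radius (P := Q) (g := fun y => (ψ (θ.symm y)).1 i)
      (((continuous_apply i).comp continuous_subtype_val).comp θ.symm.continuous)
    refine ⟨n, fun x y hxy => ?_⟩
    have := hn (θ x) (θ y) hxy
    rwa [θ.symm_apply_apply, θ.symm_apply_apply] at this
  choose n hn using hn
  let N := (Finset.Icc (-(m : ℤ)) m).sup n
  have hN : ∀ x y, window η N x y → window ψ m x y := fun x y hxy i hi =>
    hn i x y (window_mono (Finset.le_sup (Finset.mem_Icc.2 (abs_le.1 hi))) hxy)
  -- This preliminary refinement is needed because the letters of `P` alone need not determine the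
  -- zeroth `η`-symbol.
  obtain ⟨R, ξ, hR, hRe, hξ, hξs, hk⟩ :=
    exists_window_cover hP hψ Function.surjective_id hψ (fun _ _ h => h) m
  obtain ⟨R', ξ', hR', hRe', hξ', hξs', hk'⟩ :=
    exists_window_cover hRe hξ hξs hη (fun x y h => hm x y ((hk x y).1 h).2) N
  obtain ⟨W, ζ, hW, hWe, hζ, hζs, hw⟩ :=
    exists_window_cover hQ hη hηs hη (fun _ _ h => h) N
  refine (hR.trans hR').trans (EvenEquiv.trans ?_ hW.symm)
  refine evenEquiv_of_same_kernel hRe' hWe hξ' hζ hξs' hζs fun x y => ?_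
  rw [hk', hk, hw]
  refine ⟨fun h => ⟨hm x y h.1.2, h.2⟩, fun h => ⟨⟨?_, hN x y h.2⟩, h.2⟩⟩
  exact hN x y h.2 0 (by simp)

theorem evenEquiv_iff_conjugate (P Q : FlipPair.{u}) :
    EvenEquiv P Q ↔ P.system.Conjugate Q.system := by
  refine ⟨EvenEquiv.conjugate, fun h => ?_⟩
  obtain ⟨P', hP, hPe⟩ := P.exists_essential
  obtain ⟨Q', hQ, hQe⟩ := Q.exists_essential
  exact hP.trans ((evenEquiv_of_conjugate_of_essential hPe hQe
    ((hP.conjugate.symm.trans h).trans hQ.conjugate)).trans hQ.symm)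

end FlipPair

theorem propositionA (P Q : FlipPair.{u}) :
    (P.system.Conjugate Q.system ↔
      ∃ l : ℕ, 0 < l ∧ FlipPair.StrongShiftEquiv (2 * l) P Q) ∧
    (P.system.Conjugate Q.system.twist ↔
      ∃ l : ℕ, 0 < l ∧ FlipPair.StrongShiftEquiv (2 * l - 1) P Q) := by
  refine ⟨(FlipPair.evenEquiv_iff_conjugate P Q).symm, fun h => ?_, fun ⟨l, hl, h⟩ => ?_⟩
  -- Passing to the edge pair twists `Q` once more, so the two twists cancel; returning from
  -- `Q.edge` adds one to the even lag `2 * l`, and `2 * l + 1 = 2 * (l + 1) - 1`.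
  · have hQ := Q.halfRel_edge
    have hc : P.system.Conjugate Q.edge.system :=
      (h.trans hQ.conjugate_twist.twist).trans (FlipSystem.conjugate_twist_twist _).symm
    obtain ⟨l, -, hl⟩ := (FlipPair.evenEquiv_iff_conjugate P Q.edge).2 hc
    exact ⟨l + 1, l.succ_pos, hl.trans hQ.symm.strongShiftEquiv⟩
  · exact h.conjugate.2 ⟨l - 1, by omega⟩
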